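/- Let $\mathcal A$ and $\mathcal B$ be complex unital $C^*$-algebras with identities $e\neq 0$, and let $T:\mathcal A\to\mathcal B$ be a bounded unital homomorphism of complex algebras (not assumed to preserve the involution). Write $\sigma$ for the spectrum. For $a\in\mathcal A$ call $a$ *$T$-Fredholm* if $Ta$ is invertible in $\mathcal B$, and *$T$-Weyl* if $a=c+d$ with $Tc=0$ and $d\in\mathcal A$ invertible. Put $$\sigma_T(a)=\{\lambda\in\mathbb C:\lambda e-a\text{ is not }T\text{-Fredholm}\},\qquad \omega_T(a)=\{\lambda\in\mathbb C:\lambda e-a\text{ is not }T\text{-Weyl}\}.$$ The element $a$ is *$T$-Riesz* if $\lambda e-a$ is $T$-Fredholm for every $\lambda\in\mathbb C\setminus\{0\}$, and *polynomially $T$-Riesz* if $P(a)$ is $T$-Riesz for some non-zero complex polynomial $P$. Suppose that $T$ has the *strong Riesz property*: for every $x\in\mathcal A$, $$\partial\sigma(x)\subseteq\sigma_T(x)\cup\operatorname{iso}\sigma(x),$$ where $\partial$ denotes the topological boundary in $\mathbb C$ and $\operatorname{iso}$ the set of isolated points. **Theorem.** For every $a\in\mathcal A$, $a$ is polynomially $T$-Riesz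 if and only if $\omega_T(a)$ is finite. In that case there are $c,d,f\in\mathcal A$ with $a=c+d+f$, where $Tc=0$, $d$ is quasinilpotent (its spectral radius is $0$), and $\sigma(f)=\omega_T(a)$. -/

import Mathlib

namespace HomFredholm

open Polynomial

/-- The isolated points of a set `K` of complex numbers: the points of `K` that are not
accumulation points of `K`. -/
def isolatedPts (K : Set ℂ) : Set ℂ :=
  {z | z ∈ K ∧ ¬ AccPt z (Filter.principal K)}

section

variable {A B : Type*} [CStarAlgebra A] [CStarAlgebra B]

/-- An element is quasinilpotent if its spectral radius is zero. -/
def IsQuasinilpotent (a : A) : Prop :=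
  spectralRadius ℂ a = 0

/-- `T` is bounded: `‖T a‖ ≤ C ‖a‖` for some constant `C`. -/
def IsBoundedHom (T : A →ₐ[ℂ] B) : Prop :=
  ∃ C : ℝ, ∀ a : A, ‖T a‖ ≤ C * ‖a‖

/-- `a` is `T`-Fredholm if `T a` is invertible. -/
def IsFredholm (T : A →ₐ[ℂ] B) (a : A) : Prop :=
  IsUnit (T a)

/-- `a` is `T`-Weyl if `a = c + d` with `T c = 0` and `d` invertible. -/
def IsWeyl (T : A →ₐ[ℂ] B) (a : A) : Prop :=
  ∃ c d : A, T c = 0 ∧ IsUnit d ∧ a = c + d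

/-- The `T`-Fredholm spectrum. -/
def fredholmSpectrum (T : A →ₐ[ℂ] B) (a : A) : Set ℂ :=
  {z | ¬ IsFredholm T (algebraMap ℂ A z - a)}

/-- The `T`-Weyl spectrum. -/
def weylSpectrum (T : A →ₐ[ℂ] B) (a : A) : Set ℂ :=
  {z | ¬ IsWeyl T (algebraMap ℂ A z - a)}

/-- The strong Riesz property: every boundary point of the spectrum of every element lies in
its `T`-Fredholm spectrum or is an isolated point of its spectrum. -/
def StrongRieszProperty (T : A →ₐ[ℂ] B) : Prop :=
  ∀ a : A, frontier (spectrum ℂ a) ⊆ fredholmSpectrum T a ∪ isolatedPts (spectrum ℂ a)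

/-- `a` is `T`-Riesz if `z • 1 - a` is `T`-Fredholm for every nonzero `z`. -/
def IsRiesz (T : A →ₐ[ℂ] B) (a : A) : Prop :=
  ∀ z : ℂ, z ≠ 0 → IsFredholm T (algebraMap ℂ A z - a)

/-- `a` is polynomially `T`-Riesz if `P(a)` is `T`-Riesz for some nonzero polynomial `P`. -/
def IsPolyRiesz (T : A →ₐ[ℂ] B) (a : A) : Prop :=
  ∃ P : ℂ[X], P ≠ 0 ∧ IsRiesz T (aeval a P)

end

end HomFredholm

/-! ### Quasinilpotent elements and circle integrals. -/

section BanachAlgebra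

open Filter Topology Complex Metric Set

variable {A : Type*} [NormedRing A] [NormedAlgebra ℂ A]

/-! Since `fredholmSpectrum T a` is the spectrum of `T a`, spectral mapping makes polynomially Riesz
equivalent to its finiteness. Once it is finite, a connectedness argument
(`not_accPt_of_frontier_subset`) turns the strong Riesz property into: the spectrum of `a`
accumulates only on the Fredholm spectrum. At any other point `z` there is a spectral idempotent
`p`; it lies in the kernel of `T` and `z - a - p` is invertible, so the Weyl and Fredholm spectra
coincide.

For the decomposition, the remaining spectral points `μ n` have orthogonal idempotents `p n` in the
kernel. These need not be bounded, so they are replaced by the orthogonal projections `e n` obtained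
from the range projections of their partial sums. With `c n` the displacement of `μ n` from a
nearest point of the Fredholm spectrum, `c n` tends to zero, so `k = ∑ c n • e n` converges in norm
and `T k = 0`. Relative to these projections the relevant part of `a - k` is triangular with its
diagonal spectrum moved into the Fredholm spectrum, and `exists_ker_perturbation` shows that no
isolated spectral point is left outside. The strong Riesz property, applied again to `a - k`, makes
its spectrum equal to the finite Fredholm spectrum, and `exists_add_of_finite_spectrum` splits off
the quasinilpotent part.

Most vanishing statements come from one cancellation, `eq_zero_of_eq_mul_mul`. -/

theorem spectralRadius_eq_zero_of_forall_isUnit {x : A}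
    (h : ∀ z : ℂ, z ≠ 0 → IsUnit (algebraMap ℂ A z - x)) : spectralRadius ℂ x = 0 := by
  simp only [spectralRadius, ENNReal.iSup_eq_zero]
  intro z hz
  by_cases h0 : z = 0
  · simp [h0]
  · exact absurd (h z h0) hz

theorem isUnit_of_spectralRadius_eq_zero {x : A} (h : spectralRadius ℂ x = 0) {z : ℂ}
    (hz : z ≠ 0) : IsUnit (algebraMap ℂ A z - x) := by
  by_contra hcon
  have : (‖z‖₊ : ENNReal) ≤ spectralRadius ℂ x :=
    le_iSup₂ (f := fun (k : ℂ) (_ : k ∈ spectrum ℂ x) => (‖k‖₊ : ENNReal)) z hcon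
  rw [h] at this
  simp [hz] at this

theorem circleIntegral_swap {f : ℂ → ℂ → A} {c : ℂ} {r s : ℝ}
    (hf : ContinuousOn (Function.uncurry f) (sphere c |r| ×ˢ sphere c |s|)) :
    (∮ z in C(c, r), ∮ w in C(c, s), f z w) = ∮ w in C(c, s), ∮ z in C(c, r), f z w := by
  simp only [circleIntegral, ← intervalIntegral.integral_smul]
  have hcont : Continuous (fun q : ℝ × ℝ => deriv (circleMap c r) q.1 •
      deriv (circleMap c s) q.2 • f (circleMap c r q.1) (circleMap c s q.2)) := by
    have h1 : Continuous fun q : ℝ × ℝ => f (circleMap c r q.1) (circleMap c s q.2) := by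
      refine hf.comp_continuous (f := fun q : ℝ × ℝ => (circleMap c r q.1, circleMap c s q.2))
        ?_ ?_
      · fun_prop
      · intro q
        exact ⟨circleMap_mem_sphere' _ _ _, circleMap_mem_sphere' _ _ _⟩
    have h2 : ∀ t, Continuous fun x : ℝ => circleMap 0 t x * I := fun t => by fun_prop
    simp only [deriv_circleMap]
    exact ((h2 r).comp continuous_fst).smul (((h2 s).comp continuous_snd).smul h1)
  rw [MeasureTheory.intervalIntegral_intervalIntegral_swap]
  · exact intervalIntegral.integral_congr fun w _ =>
      intervalIntegral.integral_congr fun z _ => smul_comm _ _ _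
  · refine (hcont.continuousOn.integrableOn_compact
      (isCompact_uIcc.prod isCompact_uIcc)).mono_set
      (prod_mono uIoc_subset_uIcc uIoc_subset_uIcc)

theorem commute_resolvent {a x : A} (h : Commute a x) (w : ℂ) : Commute (resolvent a w) x := by
  have hc : Commute (algebraMap ℂ A w - a) x := Commute.sub_left (Algebra.commutes w x) h
  by_cases hu : IsUnit (algebraMap ℂ A w - a)
  · obtain ⟨u, hu⟩ := hu
    rw [resolvent, ← hu, Ring.inverse_unit]
    rw [← hu] at hc
    exact hc.units_inv_left
  · rw [resolvent, Ring.inverse_non_unit _ hu]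
    exact Commute.zero_left x

variable [CompleteSpace A]

/-- If `x` is quasinilpotent, then `y = x * y * v` forces `y = 0`. -/
theorem eq_zero_of_eq_mul_mul {x y v : A} (hx : spectralRadius ℂ x = 0)
    (h : y = x * y * v) : y = 0 := by
  have hpow : ∀ m : ℕ, y = x ^ m * y * v ^ m := by
    intro m
    induction m with
    | zero => simp
    | succ m ih =>
      calc y = x * y * v := h
        _ = x * (x ^ m * y * v ^ m) * v := by rw [← ih]
        _ = x ^ (m + 1) * y * v ^ (m + 1) := by rw [pow_succ', pow_succ]; noncomm_ring
  have hlim := spectrum.pow_norm_pow_one_div_tendsto_nhds_spectralRadius x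
  rw [hx] at hlim
  -- Chosen so that `δ * (‖v‖ + 1) = 1 / 2`, which makes `y = x ^ m * y * v ^ m` a strict
  -- contraction of `‖y‖`.
  set δ : ℝ := 1 / (2 * (‖v‖ + 1)) with hδ
  have hδ0 : 0 < δ := by positivity
  have hev : ∀ᶠ m : ℕ in atTop, ENNReal.ofReal (‖x ^ m‖ ^ (1 / m : ℝ)) < ENNReal.ofReal δ :=
    hlim.eventually (gt_mem_nhds (by simpa using hδ0))
  obtain ⟨m, hm, hm1⟩ := (hev.and (eventually_ge_atTop 1)).exists
  have hm' : ‖x ^ m‖ ^ (1 / m : ℝ) < δ := (ENNReal.ofReal_lt_ofReal_iff hδ0).1 hm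
  have hm0 : (m : ℝ) ≠ 0 := by positivity
  have hxm : ‖x ^ m‖ ≤ δ ^ m := by
    calc ‖x ^ m‖ = (‖x ^ m‖ ^ (1 / m : ℝ)) ^ m := by
          rw [← Real.rpow_natCast, ← Real.rpow_mul (norm_nonneg _), one_div_mul_cancel hm0,
            Real.rpow_one]
      _ ≤ δ ^ m := by gcongr
  have hvm : ‖v ^ m‖ ≤ (‖v‖ + 1) ^ m :=
    (norm_pow_le' v hm1).trans (by gcongr; linarith)
  have hy : ‖y‖ ≤ (1 / 2) ^ m * ‖y‖ := by
    calc ‖y‖ = ‖x ^ m * y * v ^ m‖ := by rw [← hpow m]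
      _ ≤ ‖x ^ m‖ * ‖y‖ * ‖v ^ m‖ := norm_mul₃_le
      _ ≤ δ ^ m * ‖y‖ * (‖v‖ + 1) ^ m := by gcongr
      _ = (δ * (‖v‖ + 1)) ^ m * ‖y‖ := by rw [mul_pow]; ring
      _ = (1 / 2) ^ m * ‖y‖ := by
          congr 2
          have : ‖v‖ + 1 ≠ 0 := by positivity
          rw [hδ]; field_simp
  have hhalf : (1 / 2 : ℝ) ^ m < 1 := pow_lt_one₀ (by norm_num) (by norm_num) (by omega)
  have := norm_nonneg y
  exact norm_eq_zero.1 (by nlinarith)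

/-! ### Riesz integrals of the resolvent. -/

theorem mul_circleIntegral (x : A) {f : ℂ → A} {c : ℂ} {r : ℝ}
    (hf : CircleIntegrable f c r) : x * (∮ w in C(c, r), f w) = ∮ w in C(c, r), x * f w := by
  have h := (ContinuousLinearMap.mul ℂ A x).intervalIntegral_comp_comm hf.out
  simpa [circleIntegral] using h.symm

theorem circleIntegral_mul (x : A) {f : ℂ → A} {c : ℂ} {r : ℝ}
    (hf : CircleIntegrable f c r) : (∮ w in C(c, r), f w) * x = ∮ w in C(c, r), f w * x := by
  have h := ((ContinuousLinearMap.mul ℂ A).flip x).intervalIntegral_comp_comm hf.out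
  simpa [circleIntegral] using h.symm

/-- The circle integral of the resolvent over a circle in the resolvent set. -/
noncomputable def rieszIntegral (a : A) (c : ℂ) (r : ℝ) : A :=
  (2 * Real.pi * I : ℂ)⁻¹ • ∮ w in C(c, r), resolvent a w

/-- The Cauchy transform of the resolvent over a circle in the resolvent set. -/
noncomputable def rieszCauchy (a : A) (c : ℂ) (r : ℝ) (z : ℂ) : A :=
  (2 * Real.pi * I : ℂ)⁻¹ • ∮ w in C(c, r), (z - w)⁻¹ • resolvent a w

theorem commute_rieszIntegral {a x : A} {c : ℂ} {r : ℝ} (h : Commute a x)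
    (hf : CircleIntegrable (resolvent a) c r) : Commute (rieszIntegral a c r) x := by
  refine Commute.smul_left ?_ _
  rw [Commute, SemiconjBy, mul_circleIntegral x hf, circleIntegral_mul x hf]
  simp only [(commute_resolvent h _).eq]

theorem commute_rieszCauchy {a x : A} {c z : ℂ} {r : ℝ} (h : Commute a x)
    (hf : CircleIntegrable (fun w => (z - w)⁻¹ • resolvent a w) c r) :
    Commute (rieszCauchy a c r z) x := by
  refine Commute.smul_left ?_ _
  rw [Commute, SemiconjBy, mul_circleIntegral x hf, circleIntegral_mul x hf]
  simp only [((commute_resolvent h _).smul_left _).eq]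

theorem continuousOn_resolvent (a : A) : ContinuousOn (resolvent a) (resolventSet ℂ a) :=
  fun _ hz => (spectrum.hasDerivAt_resolvent_const_left hz).continuousAt.continuousWithinAt

theorem continuousOn_inv_smul_resolvent {a : A} {c z : ℂ} {r : ℝ}
    (hs : sphere c r ⊆ resolventSet ℂ a) (hz : z ∉ sphere c r) :
    ContinuousOn (fun w => (z - w)⁻¹ • resolvent a w) (sphere c r) := by
  refine ContinuousOn.smul (ContinuousOn.inv₀ (by fun_prop) ?_)
    ((continuousOn_resolvent a).mono hs)
  intro w hw h0
  exact hz (by rwa [sub_eq_zero.1 h0])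

/-- Writing `z - a = (z - w) + (w - a)` under the integral cancels the kernel in one term and the
resolvent in the other. The scalar integral left over distinguishes points outside the circle from
its centre. -/
theorem sub_mul_rieszCauchy {a : A} {c z : ℂ} {r : ℝ} (hr : 0 < r)
    (hs : sphere c r ⊆ resolventSet ℂ a) (hz : z ∉ sphere c r) :
    (algebraMap ℂ A z - a) * rieszCauchy a c r z =
      rieszIntegral a c r + ((2 * Real.pi * I : ℂ)⁻¹ * ∮ w in C(c, r), (z - w)⁻¹) • (1 : A) := by
  have h1 := (continuousOn_inv_smul_resolvent hs hz).circleIntegrable hr.le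
  have h2 := ((continuousOn_resolvent a).mono hs).circleIntegrable hr.le
  have h3 : ContinuousOn (fun w => (z - w)⁻¹) (sphere c r) :=
    ContinuousOn.inv₀ (by fun_prop) fun w hw h0 => hz (by rwa [sub_eq_zero.1 h0])
  have h4 : ContinuousOn (fun w => (z - w)⁻¹ • (1 : A)) (sphere c r) :=
    h3.smul continuousOn_const
  rw [rieszCauchy, mul_smul_comm, mul_circleIntegral _ h1, rieszIntegral, mul_smul, ← smul_add,
    ← circleIntegral.integral_smul_const, ← circleIntegral.integral_add h2
      (h4.circleIntegrable hr.le)]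
  congr 1
  refine circleIntegral.integral_congr hr.le fun w hw => ?_
  have hw0 : z - w ≠ 0 := fun h0 => hz (by rwa [sub_eq_zero.1 h0])
  have hR : (algebraMap ℂ A w - a) * resolvent a w = 1 := Ring.mul_inverse_cancel _ (hs hw)
  have : algebraMap ℂ A z - a = (z - w) • (1 : A) + (algebraMap ℂ A w - a) := by
    rw [← Algebra.algebraMap_eq_smul_one, map_sub]; abel
  rw [mul_smul_comm, this, add_mul, hR, smul_add, smul_mul_assoc, one_mul, smul_smul,
    inv_mul_cancel₀ hw0, one_smul]

theorem sub_mul_rieszCauchy_of_lt {a : A} {c z : ℂ} {r : ℝ} (hr : 0 < r)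
    (hs : sphere c r ⊆ resolventSet ℂ a) (hz : r < dist z c) :
    (algebraMap ℂ A z - a) * rieszCauchy a c r z = rieszIntegral a c r := by
  rw [sub_mul_rieszCauchy hr hs (fun h => hz.ne' h)]
  have : (∮ w in C(c, r), (z - w)⁻¹) = 0 := by
    refine circleIntegral_eq_zero_of_differentiable_on_off_countable hr.le countable_empty ?_ ?_
    · refine ContinuousOn.inv₀ (by fun_prop) fun w hw h0 => ?_
      rw [sub_eq_zero.1 h0] at hz
      exact absurd hw (not_le.2 hz)
    · intro w hw
      refine DifferentiableAt.inv (by fun_prop) fun h0 => ?_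
      rw [sub_eq_zero.1 h0] at hz
      exact absurd (mem_ball.1 hw.1) (not_lt.2 hz.le)
  simp [this]

theorem sub_mul_rieszCauchy_self {a : A} {c : ℂ} {r : ℝ} (hr : 0 < r)
    (hs : sphere c r ⊆ resolventSet ℂ a) :
    (algebraMap ℂ A c - a) * rieszCauchy a c r c = rieszIntegral a c r - 1 := by
  rw [sub_mul_rieszCauchy hr hs (fun h => hr.ne (by simpa using h))]
  have : (∮ w in C(c, r), (c - w)⁻¹) = -(2 * Real.pi * I : ℂ) := by
    rw [← circleIntegral.integral_sub_center_inv c hr.ne', neg_eq_neg_one_mul,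
      ← circleIntegral.integral_const_mul]
    refine circleIntegral.integral_congr hr.le fun w _ => ?_
    simp only [← neg_sub w c, inv_neg, neg_mul, one_mul]
  have h0 : (2 * Real.pi * I : ℂ) ≠ 0 := two_pi_I_ne_zero
  rw [this, mul_neg, inv_mul_cancel₀ h0, neg_smul, one_smul, sub_eq_add_neg]

theorem rieszIntegral_eq {a : A} {c : ℂ} {r s : ℝ} (hr : 0 < r) (hrs : r ≤ s)
    (hs : closedBall c s \ {c} ⊆ resolventSet ℂ a) :
    rieszIntegral a c s = rieszIntegral a c r := by
  have hsub : closedBall c s \ ball c r ⊆ resolventSet ℂ a := fun z hz =>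
    hs ⟨hz.1, fun h => hz.2 (by rw [mem_singleton_iff.1 h]; exact mem_ball_self hr)⟩
  rw [rieszIntegral, rieszIntegral,
    circleIntegral_eq_of_differentiable_on_annulus_off_countable hr hrs countable_empty
      ((continuousOn_resolvent a).mono hsub) fun z hz =>
        (spectrum.hasDerivAt_resolvent_const_left
          (hsub ⟨ball_subset_closedBall hz.1.1,
            fun h => hz.1.2 (ball_subset_closedBall h)⟩)).differentiableAt]

/-- Two concentric circles: on the outer one, `p * resolvent a z` is the Cauchy transform over the
inner one. Fubini and Cauchy's formula for the scalar kernel then collapse the double integral. -/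
theorem rieszIntegral_mul_self {a : A} {c : ℂ} {s : ℝ} (hs0 : 0 < s)
    (hs : closedBall c s \ {c} ⊆ resolventSet ℂ a) :
    rieszIntegral a c s * rieszIntegral a c s = rieszIntegral a c s := by
  have hr0 : 0 < s / 2 := by positivity
  have hsph : ∀ t, 0 < t → t ≤ s → sphere c t ⊆ resolventSet ℂ a := fun t ht hts z hz =>
    hs ⟨(mem_sphere.1 hz).le.trans hts, fun h => ht.ne (by
      rw [mem_singleton_iff.1 h] at hz; simpa using hz)⟩
  have hS := hsph s hs0 le_rfl
  have hR := hsph (s / 2) hr0 (by linarith)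
  have hIS := ((continuousOn_resolvent a).mono hS).circleIntegrable hs0.le
  have hIR := ((continuousOn_resolvent a).mono hR).circleIntegrable hr0.le
  set p := rieszIntegral a c s with hp
  have hpr : p = rieszIntegral a c (s / 2) := rieszIntegral_eq hr0 (by linarith) hs
  have key : ∀ z ∈ sphere c s, p * resolvent a z = rieszCauchy a c (s / 2) z := by
    intro z hz
    have hlt : s / 2 < dist z c := by rw [mem_sphere.1 hz]; linarith
    have hc : Commute a (algebraMap ℂ A z - a) :=
      Commute.sub_right (Algebra.commutes z a).symm (Commute.refl a)
    have hB := commute_rieszCauchy hc ((continuousOn_inv_smul_resolvent hR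
      (fun h => hlt.ne' h)).circleIntegrable hr0.le)
    rw [hpr, ← sub_mul_rieszCauchy_of_lt hr0 hR hlt, ← hB.eq, mul_assoc]
    have h1 : (algebraMap ℂ A z - a) * resolvent a z = 1 := Ring.mul_inverse_cancel _ (hS hz)
    rw [h1, mul_one]
  have hswap : (∮ z in C(c, s), ∮ w in C(c, s / 2), (z - w)⁻¹ • resolvent a w) =
      ∮ w in C(c, s / 2), ∮ z in C(c, s), (z - w)⁻¹ • resolvent a w := by
    apply circleIntegral_swap
    rw [abs_of_pos hs0, abs_of_pos hr0]
    refine ContinuousOn.smul (ContinuousOn.inv₀ (by fun_prop) ?_) ?_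
    · rintro ⟨z, w⟩ ⟨hz, hw⟩ h0
      have : z = w := sub_eq_zero.1 h0
      rw [mem_sphere] at hz hw
      simp only at hz hw
      rw [this, hw] at hz
      linarith
    · exact ((continuousOn_resolvent a).mono hR).comp continuousOn_snd fun q hq => hq.2
  have hin : ∀ w ∈ sphere c (s / 2), (∮ z in C(c, s), (z - w)⁻¹ • resolvent a w) =
      (2 * Real.pi * I : ℂ) • resolvent a w := by
    intro w hw
    rw [circleIntegral.integral_smul_const, circleIntegral.integral_sub_inv_of_mem_ball]
    rw [mem_ball, mem_sphere.1 hw]; linarith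
  have h0 : (2 * Real.pi * I : ℂ) ≠ 0 := two_pi_I_ne_zero
  calc p * p = (2 * Real.pi * I : ℂ)⁻¹ • ∮ z in C(c, s), p * resolvent a z := by
        rw [← mul_circleIntegral _ hIS, ← mul_smul_comm, hp, rieszIntegral]
    _ = (2 * Real.pi * I : ℂ)⁻¹ • ∮ z in C(c, s), (2 * Real.pi * I : ℂ)⁻¹ •
          ∮ w in C(c, s / 2), (z - w)⁻¹ • resolvent a w := by
        rw [circleIntegral.integral_congr hs0.le key]; rfl
    _ = (2 * Real.pi * I : ℂ)⁻¹ • (2 * Real.pi * I : ℂ)⁻¹ • (2 * Real.pi * I : ℂ) •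
          ∮ w in C(c, s / 2), resolvent a w := by
        rw [circleIntegral.integral_smul, hswap, circleIntegral.integral_congr hr0.le hin,
          circleIntegral.integral_smul]
    _ = p := by rw [hpr, rieszIntegral, smul_smul _ (2 * Real.pi * I : ℂ), inv_mul_cancel₀ h0, one_smul]

/-! ### Spectral idempotents at isolated points. -/

/-- `p` is the spectral idempotent of `a` at an isolated point `z` of the spectrum (or `p = 0` if
`z` is in the resolvent set). -/
structure IsRieszIdempotent (a : A) (z : ℂ) (p : A) : Prop where
  mul_self : p * p = p
  commute_of_commute : ∀ x, Commute a x → Commute p x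
  quasinilpotent : spectralRadius ℂ ((a - algebraMap ℂ A z) * p) = 0
  exists_inverse : ∃ b, Commute a b ∧ (a - algebraMap ℂ A z) * b = 1 - p

theorem exists_isRieszIdempotent {a : A} {c : ℂ}
    (h : ¬ AccPt c (𝓟 (spectrum ℂ a))) : ∃ p, IsRieszIdempotent a c p := by
  obtain ⟨s, hs0, hs⟩ : ∃ s : ℝ, 0 < s ∧ closedBall c s \ {c} ⊆ resolventSet ℂ a := by
    rw [accPt_iff_frequently_nhdsNE, not_frequently, eventually_nhdsWithin_iff,
      nhds_basis_closedBall.eventually_iff] at h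
    obtain ⟨s, hs0, hs⟩ := h
    exact ⟨s, hs0, fun z hz => by simpa [spectrum] using hs hz.1 hz.2⟩
  have hsph : ∀ t, 0 < t → t ≤ s → sphere c t ⊆ resolventSet ℂ a := fun t ht hts z hz =>
    hs ⟨(mem_sphere.1 hz).le.trans hts, fun h => ht.ne (by
      rw [mem_singleton_iff.1 h] at hz; simpa using hz)⟩
  set p := rieszIntegral a c s with hp
  have hS := hsph s hs0 le_rfl
  have hcomm : ∀ x, Commute a x → Commute p x := fun x hx =>
    commute_rieszIntegral hx (((continuousOn_resolvent a).mono hS).circleIntegrable hs0.le)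
  have hpp : p * p = p := rieszIntegral_mul_self hs0 hs
  refine ⟨p, hpp, hcomm, ?_, rieszCauchy a c s c, ?_, ?_⟩
  · have hpa : Commute p a := hcomm a (Commute.refl a)
    refine spectralRadius_eq_zero_of_forall_isUnit fun z hz => ?_
    -- The circle is shrunk until `c + z` lies outside it; the idempotent does not change.
    set r := min s (‖z‖ / 2)
    have hz' : 0 < ‖z‖ := norm_pos_iff.2 hz
    have hr0 : 0 < r := lt_min hs0 (by positivity)
    have hrs : r ≤ s := min_le_left _ _
    have hR := hsph r hr0 hrs
    have hlt : r < dist (c + z) c := by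
      simp only [dist_self_add_left]
      exact (min_le_right _ _).trans_lt (by linarith)
    have hB := sub_mul_rieszCauchy_of_lt hr0 hR hlt
    rw [← rieszIntegral_eq hr0 hrs hs, ← hp] at hB
    set B := rieszCauchy a c r (c + z)
    have hBc : ∀ x, Commute a x → Commute B x := fun x hx => commute_rieszCauchy hx
      ((continuousOn_inv_smul_resolvent hR fun h => hlt.ne' h).circleIntegrable hr0.le)
    have hBa : Commute B a := hBc a (Commute.refl a)
    have hBp : Commute B p := hBc p hpa.symm
    have hz1 : algebraMap ℂ A z * algebraMap ℂ A z⁻¹ = 1 := by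
      rw [← map_mul, mul_inv_cancel₀ hz, map_one]
    set ζ := algebraMap ℂ A z with hζ
    set ζ' := algebraMap ℂ A z⁻¹
    set γ := algebraMap ℂ A c
    have hγ : ∀ x, γ * x = x * γ := Algebra.commutes c
    have hζc : ∀ x, ζ * x = x * ζ := Algebra.commutes z
    have hζ'c : ∀ x, ζ' * x = x * ζ' := Algebra.commutes z⁻¹
    have hB' : (γ + ζ - a) * B = p := by rw [← hB, map_add]
    -- The inverse is assembled from the Cauchy transform on the range of `p` and the scalar `z⁻¹`
    -- on the complement.
    have hmul : (ζ - (a - γ) * p) * (B * p + ζ' * (1 - p)) = 1 := by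
      have e1 : (ζ - (a - γ) * p) * (B * p) = p := by
        calc (ζ - (a - γ) * p) * (B * p) = (ζ - (a - γ) * p) * (p * B) := by rw [hBp.eq]
          _ = (ζ * p - (a - γ) * (p * p)) * B := by noncomm_ring
          _ = (γ + ζ - a) * (p * B) := by rw [hpp]; noncomm_ring
          _ = (γ + ζ - a) * B * p := by rw [← hBp.eq, mul_assoc]
          _ = p := by rw [hB', hpp]
      have e2 : (ζ - (a - γ) * p) * (ζ' * (1 - p)) = 1 - p := by
        calc (ζ - (a - γ) * p) * (ζ' * (1 - p)) = ζ * ζ' * (1 - p)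
              - (a - γ) * (p * (1 - p)) * ζ' := by
              rw [sub_mul, mul_assoc, mul_assoc, hζ'c (1 - p)]; simp only [mul_assoc]
          _ = 1 - p := by rw [hz1, mul_sub p, hpp]; simp
      rw [mul_add, e1, e2]; abel
    have hcm : Commute (ζ - (a - γ) * p) (B * p + ζ' * (1 - p)) := by
      have c1 : Commute ζ (B * p + ζ' * (1 - p)) := hζc _
      have c2 : Commute a (B * p + ζ' * (1 - p)) :=
        (hBa.symm.mul_right hpa.symm).add_right
          (Commute.mul_right (hζ'c a).symm ((Commute.one_right a).sub_right hpa.symm))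
      have c3 : Commute γ (B * p + ζ' * (1 - p)) := hγ _
      have c4 : Commute p (B * p + ζ' * (1 - p)) :=
        (hBp.symm.mul_right (Commute.refl p)).add_right
          (Commute.mul_right (hζ'c p).symm ((Commute.one_right p).sub_right (Commute.refl p)))
      exact c1.sub_left ((c2.sub_left c3).mul_left c4)
    exact ⟨⟨_, _, hmul, by rw [← hcm.eq, hmul]⟩, rfl⟩
  · exact (commute_rieszCauchy (Commute.refl a) ((continuousOn_inv_smul_resolvent hS
      (fun h => hs0.ne (by simpa using h))).circleIntegrable hs0.le)).symm
  · have := sub_mul_rieszCauchy_self hs0 hS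
    rw [← neg_sub, neg_mul, this, neg_sub]

end BanachAlgebra

/-! ### Algebra of spectral idempotents and elements of finite spectrum. -/

section BanachAlgebra

open Filter Topology Set Polynomial

/-- Local inverses glue: the inverse of `x` is the sum of the `u⁻¹ * s i`. -/
theorem isUnit_of_sum_eq_one {R ι : Type*} [Ring R] (F : Finset ι) (s : ι → R) (hs : ∑ i ∈ F, s i = 1) {x : R}
    (h : ∀ i ∈ F, Commute x (s i) ∧ ∃ u : R, IsUnit u ∧ x * s i = u * s i ∧ Commute u (s i)) :
    IsUnit x := by
  have h' : ∀ i ∈ F, ∃ v : R, x * (v * s i) = s i ∧ (v * s i) * x = s i := by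
    intro i hi
    obtain ⟨hc, u, ⟨u, rfl⟩, hu, huc⟩ := h i hi
    have huc' : Commute ((u⁻¹ : Rˣ) : R) (s i) := huc.units_inv_left
    refine ⟨((u⁻¹ : Rˣ) : R), ?_, ?_⟩
    · rw [huc'.eq, ← mul_assoc, hu, mul_assoc, ← huc'.eq, ← mul_assoc]; simp
    · rw [mul_assoc, ← hc.eq, hu, ← mul_assoc]; simp
  choose! v hv using h'
  have h1 : x * ∑ i ∈ F, v i * s i = 1 := by
    rw [Finset.mul_sum, ← hs]; exact Finset.sum_congr rfl fun i hi => (hv i hi).1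
  have h2 : (∑ i ∈ F, v i * s i) * x = 1 := by
    rw [Finset.sum_mul, ← hs]; exact Finset.sum_congr rfl fun i hi => (hv i hi).2
  exact ⟨⟨_, _, h1, h2⟩, rfl⟩
variable {A : Type*} [NormedRing A] [NormedAlgebra ℂ A]

theorem IsRieszIdempotent.commute_self {a p : A} {z : ℂ} (h : IsRieszIdempotent a z p) :
    Commute p a :=
  h.commute_of_commute a (Commute.refl a)

theorem IsRieszIdempotent.commute_sub {a p : A} {z : ℂ} (h : IsRieszIdempotent a z p) (w : ℂ) :
    Commute p (a - algebraMap ℂ A w) :=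
  h.commute_self.sub_right (Algebra.commutes w p).symm

theorem IsRieszIdempotent.notMem_spectrum {a p : A} {z : ℂ} (h : IsRieszIdempotent a z p)
    (hp : p = 0) : z ∉ spectrum ℂ a := by
  obtain ⟨b, hb, hab⟩ := h.exists_inverse
  have hc : Commute (a - algebraMap ℂ A z) b := hb.sub_left (Algebra.commutes z b)
  rw [hp, sub_zero] at hab
  rw [spectrum.mem_iff, not_not, ← neg_sub, IsUnit.neg_iff]
  exact ⟨⟨_, _, hab, by rw [← hc.eq, hab]⟩, rfl⟩

/-- On the range of `p` the element is the identity plus a quasinilpotent; on the complement `b`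
inverts it. In the code, it is one of two commuting factors of the unit `1 + (a - z) * p`. -/
theorem IsRieszIdempotent.isUnit_sub_add {a p : A} {z : ℂ} (h : IsRieszIdempotent a z p) :
    IsUnit (a - algebraMap ℂ A z + p) := by
  obtain ⟨b, hb, hab⟩ := h.exists_inverse
  have hpb : Commute p b := h.commute_of_commute b hb
  have hpa := h.commute_sub z
  have hc : Commute (a - algebraMap ℂ A z) b := hb.sub_left (Algebra.commutes z b)
  have hu : IsUnit (1 + (a - algebraMap ℂ A z) * p) := by
    have := isUnit_of_spectralRadius_eq_zero h.quasinilpotent (z := -1) (by norm_num)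
    rw [← IsUnit.neg_iff] at this
    convert this using 1
    simp only [map_neg, map_one]; abel
  set x := a - algebraMap ℂ A z
  have hmul : (x + p) * (b * (1 - p) + p) = 1 + x * p := by
    have hp1 : (1 - p) * (1 - p) = 1 - p := by
      rw [mul_sub, sub_mul, sub_mul, h.mul_self]; simp
    have hp2 : p * b * (1 - p) = 0 := by
      rw [hpb.eq, mul_assoc, mul_sub, h.mul_self]; simp
    calc (x + p) * (b * (1 - p) + p)
        = x * b * (1 - p) + x * p + p * b * (1 - p) + p * p := by noncomm_ring
      _ = 1 + x * p := by rw [hab, hp1, hp2, h.mul_self]; abel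
  have hcm : Commute (x + p) (b * (1 - p) + p) := by
    have h1 : Commute x (b * (1 - p) + p) :=
      (hc.mul_right ((Commute.one_right x).sub_right hpa.symm)).add_right hpa.symm
    have h2 : Commute p (b * (1 - p) + p) :=
      (hpb.mul_right ((Commute.one_right p).sub_right (Commute.refl p))).add_right (Commute.refl p)
    exact h1.add_left h2
  rw [← hmul] at hu
  exact (hcm.isUnit_mul_iff.1 hu).1

/-- Homomorphisms preserve quasinilpotence, while `T a - z` is invertible: `T p = T ((a - z) * p) *
T p * (T a - z)⁻¹` forces `T p = 0`. -/
theorem IsRieszIdempotent.map_eq_zero {B : Type*} [NormedRing B] [NormedAlgebra ℂ B]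
    [CompleteSpace B] (T : A →ₐ[ℂ] B) {a p : A} {z : ℂ} (hp : IsRieszIdempotent a z p)
    (hz : z ∉ spectrum ℂ (T a)) : T p = 0 := by
  rw [spectrum.mem_iff, not_not, ← neg_sub, IsUnit.neg_iff] at hz
  obtain ⟨u, hu⟩ := hz
  have hx : spectralRadius ℂ (T ((a - algebraMap ℂ A z) * p)) = 0 := by
    refine spectralRadius_eq_zero_of_forall_isUnit fun w hw => ?_
    have := (isUnit_of_spectralRadius_eq_zero hp.quasinilpotent hw).map T
    rwa [map_sub, AlgHom.commutes] at this
  refine eq_zero_of_eq_mul_mul (v := ((u⁻¹ : Bˣ) : B)) hx ?_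
  have hc : T (a - algebraMap ℂ A z) * T p = T p * T (a - algebraMap ℂ A z) := by
    rw [← map_mul, ← map_mul, (hp.commute_sub z).eq]
  have hu' : T (a - algebraMap ℂ A z) = u := by rw [hu, map_sub, AlgHom.commutes]
  rw [map_mul, mul_assoc, mul_assoc, ← mul_assoc (T p), ← map_mul, hp.mul_self, ← mul_assoc, hc,
    hu', mul_assoc, Units.mul_inv, mul_one]

variable [CompleteSpace A]

/-- On the range of `p * q` both `a - z` and `a - w` would be quasinilpotent, although they differ
by a nonzero scalar. -/
theorem IsRieszIdempotent.mul_eq_zero {a p q : A} {z w : ℂ} (hp : IsRieszIdempotent a z p)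
    (hq : IsRieszIdempotent a w q) (hzw : z ≠ w) : p * q = 0 := by
  have hpq : Commute p q := hp.commute_of_commute q hq.commute_self.symm
  obtain ⟨u, hu⟩ := isUnit_of_spectralRadius_eq_zero hp.quasinilpotent (z := w - z)
    (sub_ne_zero.2 hzw.symm)
  refine eq_zero_of_eq_mul_mul (v := -((u⁻¹ : Aˣ) : A)) hq.quasinilpotent ?_
  have key : (a - algebraMap ℂ A w) * q * (p * q) = - (p * q * u) := by
    have e1 : (a - algebraMap ℂ A w) * q * (p * q) = p * q * (a - algebraMap ℂ A w) := by
      calc _ = (a - algebraMap ℂ A w) * (q * q * p) := by rw [hpq.eq]; noncomm_ring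
        _ = (a - algebraMap ℂ A w) * (p * q) := by rw [hq.mul_self, hpq.eq]
        _ = p * q * (a - algebraMap ℂ A w) :=
          ((hp.commute_sub w).mul_left (hq.commute_sub w)).eq.symm
    have e2 : p * q * ((a - algebraMap ℂ A z) * p) = p * q * (a - algebraMap ℂ A z) := by
      rw [← (hp.commute_sub z).eq, hpq.eq, ← mul_assoc, mul_assoc q p p, hp.mul_self]
    rw [hu, mul_sub, e2, e1, map_sub]
    noncomm_ring
  rw [key, neg_mul_neg, mul_assoc, Units.mul_inv, mul_one]

/-- An element with finite spectrum is the sum of a quasinilpotent element and a linear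
combination of idempotents with the same spectrum. -/
theorem exists_add_of_finite_spectrum [Nontrivial A] {g : A} (hg : (spectrum ℂ g).Finite) :
    ∃ d f : A, g = d + f ∧ spectralRadius ℂ d = 0 ∧ spectrum ℂ f = spectrum ℂ g := by
  have hacc : ∀ z, ¬ AccPt z (𝓟 (spectrum ℂ g)) := fun z hz =>
    Set.Infinite.of_accPt hz hg
  choose s hs using fun z => exists_isRieszIdempotent (hacc z)
  set F := hg.toFinset with hF
  have hss : ∀ z w, z ≠ w → s z * s w = 0 := fun z w h => (hs z).mul_eq_zero (hs w) h
  have hscomm : ∀ z w, Commute (s z) (s w) := fun z w =>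
    (hs z).commute_of_commute _ (hs w).commute_self.symm
  have hsum_mul : ∀ (c : ℂ → A), ∀ z ∈ F, (∑ w ∈ F, c w * s w) * s z = c z * s z := by
    intro c z hz
    rw [Finset.sum_mul, Finset.sum_eq_single_of_mem z hz, mul_assoc, (hs z).mul_self]
    intro w _ hw
    rw [mul_assoc, hss w z hw, mul_zero]
  have hone : ∑ z ∈ F, s z = 1 := by
    set t := 1 - ∑ z ∈ F, s z with ht
    have htz : ∀ z ∈ F, s z * t = 0 := by
      intro z hz
      rw [ht, mul_sub, mul_one, Finset.mul_sum, Finset.sum_eq_single_of_mem z hz, (hs z).mul_self,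
        sub_self]
      exact fun w _ hw => hss z w hw.symm
    have htc : Commute t g :=
      (Commute.one_left g).sub_left (Commute.sum_left _ _ _ fun z _ => (hs z).commute_self)
    -- Since `s z * t = 0`, the partial inverse of `g - z` gives `t = (g - z) * t * b`. Iterating
    -- over all of `F` produces a polynomial in `g` that vanishes on the spectrum, hence is
    -- quasinilpotent, and so `t = 0`.
    have hprod : ∀ G ⊆ F, ∃ v, t = aeval g (∏ z ∈ G, (X - C z) : ℂ[X]) * t * v := by
      intro G
      induction G using Finset.induction_on with
      | empty => exact fun _ => ⟨1, by simp⟩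
      | insert z G hz ih =>
        intro hG
        obtain ⟨v, hv⟩ := ih ((Finset.subset_insert z G).trans hG)
        obtain ⟨b, hb, hgb⟩ := (hs z).exists_inverse
        have htb : Commute t b := (Commute.one_left b).sub_left
          (Commute.sum_left _ _ _ fun z _ => (hs z).commute_of_commute b hb)
        have htg : Commute t (g - algebraMap ℂ A z) :=
          htc.sub_right (Algebra.commutes z t).symm
        refine ⟨v * b, ?_⟩
        rw [Finset.prod_insert hz, map_mul]
        have e : aeval g (X - C z : ℂ[X]) = g - algebraMap ℂ A z := by simp
        rw [e, mul_assoc, mul_assoc, ← mul_assoc t, ← mul_assoc (aeval g _),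
          ← mul_assoc (aeval g _) t v, ← hv, ← mul_assoc, ← htg.eq, mul_assoc, hgb, 
          ((Commute.one_right t).sub_right
            (htc.symm |> (hs z).commute_of_commute t).symm).eq, sub_mul,
          htz z (hG (Finset.mem_insert_self z G)), one_mul, sub_zero]
    obtain ⟨v, hv⟩ := hprod F subset_rfl
    have hquasi : spectralRadius ℂ (aeval g (∏ z ∈ F, (X - C z) : ℂ[X])) = 0 := by
      refine spectralRadius_eq_zero_of_forall_isUnit fun w hw => ?_
      by_contra hcon
      have : w ∈ spectrum ℂ (aeval g (∏ z ∈ F, (X - C z) : ℂ[X])) := hcon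
      rw [spectrum.map_polynomial_aeval] at this
      obtain ⟨y, hy, hyw⟩ := this
      apply hw
      rw [← hyw]
      change eval y _ = 0
      rw [eval_prod]
      exact Finset.prod_eq_zero (hg.mem_toFinset.2 hy) (by simp)
    exact (sub_eq_zero.1 (eq_zero_of_eq_mul_mul hquasi hv)).symm
  have hf_mul : ∀ z ∈ F, (∑ w ∈ F, algebraMap ℂ A w * s w) * s z = algebraMap ℂ A z * s z :=
    hsum_mul _
  set f := ∑ w ∈ F, algebraMap ℂ A w * s w with hf
  have hfc : ∀ z, Commute f (s z) := fun z => Commute.sum_left _ _ _ fun w _ =>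
    Commute.mul_left (Algebra.commutes w _) (hscomm w z)
  refine ⟨g - f, f, by abel, ?_, ?_⟩
  · refine spectralRadius_eq_zero_of_forall_isUnit fun w hw => ?_
    refine isUnit_of_sum_eq_one F s hone fun z hz => ⟨?_, _,
      isUnit_of_spectralRadius_eq_zero (hs z).quasinilpotent hw, ?_, ?_⟩
    · exact Commute.sub_left (Algebra.commutes w _) ((hs z).commute_self.symm.sub_left (hfc z))
    · rw [sub_mul _ (g - f), sub_mul g, hf_mul z hz, sub_mul _ (_ * _), mul_assoc _ (s z),
        (hs z).mul_self, sub_mul g]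
    · exact Commute.sub_left (Algebra.commutes w _)
        (((hs z).commute_sub z).symm.mul_left (Commute.refl _))
  · ext w
    constructor
    · contrapose!
      intro hw
      rw [spectrum.mem_iff, not_not]
      refine isUnit_of_sum_eq_one F s hone fun z hz => ⟨?_, algebraMap ℂ A (w - z), ?_, ?_, ?_⟩
      · exact Commute.sub_left (Algebra.commutes w _) (hfc z)
      · refine (IsUnit.mk0 _ (sub_ne_zero.2 fun h => hw ?_)).map (algebraMap ℂ A)
        rw [h]; exact hg.mem_toFinset.1 hz
      · rw [sub_mul, hf_mul z hz, map_sub, sub_mul]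
      · exact Algebra.commutes _ _
    · intro hw
      have hne : s w ≠ 0 := fun h => (hs w).notMem_spectrum h hw
      rw [spectrum.mem_iff]
      intro hu
      apply hne
      rw [← hu.mul_right_eq_zero, sub_mul, hf_mul w (hg.mem_toFinset.2 hw), sub_self]

end BanachAlgebra

/-! ### Accumulation points of compact plane sets. -/

section Topology

open Filter Topology Set Metric

/-- Off `F`, the derived set and the interior of `K` agree, so this set is both open and closed in
the connected set `Fᶜ`. Boundedness of `K` prevents it from being everything. -/
theorem not_accPt_of_frontier_subset {K F : Set ℂ} (hK : IsCompact K) (hF : F.Finite)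
    (h : frontier K ⊆ F ∪ HomFredholm.isolatedPts K) {z : ℂ} (hz : z ∉ F) :
    ¬ AccPt z (𝓟 K) := by
  intro hacc
  have hsub : ∀ w ∈ derivedSet K, w ∉ F → w ∈ interior K := by
    intro w hw hwF
    have hwK : w ∈ K := hK.isClosed.closure_eq ▸ mem_closure_iff_clusterPt.2 hw.clusterPt
    by_contra hint
    rcases h ⟨subset_closure hwK, hint⟩ with h1 | h1
    · exact hwF h1
    · exact h1.2 hw
  have hint : interior K ⊆ derivedSet K := by
    intro w hw
    have : AccPt w (𝓟 (interior K)) := by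
      rw [accPt_iff_frequently_nhdsNE]
      refine Eventually.frequently ?_
      exact nhdsWithin_le_nhds (isOpen_interior.mem_nhds hw)
    exact this.mono (principal_mono.2 interior_subset)
  have hconn : IsPreconnected Fᶜ :=
    (hF.countable.isConnected_compl_of_one_lt_rank (by simp)).isPreconnected
  have hne : (Fᶜ ∩ (derivedSet K)ᶜ).Nonempty := by
    by_contra hcon
    rw [not_nonempty_iff_eq_empty] at hcon
    have hb : Bornology.IsBounded (F ∪ K) := hF.isBounded.union hK.isBounded
    have : F ∪ K = univ := by
      rw [eq_univ_iff_forall]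
      intro w
      by_contra hw
      rw [mem_union, not_or] at hw
      have : w ∈ Fᶜ ∩ (derivedSet K)ᶜ :=
        ⟨hw.1, fun hd => hw.2 (interior_subset (hsub w hd hw.1))⟩
      rw [hcon] at this
      exact this
    rw [this] at hb
    exact NormedSpace.unbounded_univ ℂ ℂ hb
  obtain ⟨w, -, hw1, hw2⟩ := hconn (interior K) (derivedSet K)ᶜ isOpen_interior
    (isClosed_derivedSet K).isOpen_compl
    (fun w hw => by
      by_cases hd : w ∈ derivedSet K
      · exact Or.inl (hsub w hd hw)
      · exact Or.inr hd) ⟨z, hz, hsub z hacc hz⟩ hne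
  exact hw2 (hint hw1)

/-- A compact set accumulating only at points of a finite set `F` is approximated by `F`. -/
theorem exists_nearest_point {K F : Set ℂ} (hK : IsCompact K) (hF : F.Finite) (hne : F.Nonempty)
    (h : ∀ z, z ∉ F → ¬ AccPt z (𝓟 K)) :
    ∃ ν : ℂ → ℂ, (∀ z, ν z ∈ F) ∧ ∀ ε > 0, {z ∈ K \ F | ε ≤ ‖z - ν z‖}.Finite := by
  choose ν hνF hν using fun z => hF.isCompact.exists_infDist_eq_dist hne z
  refine ⟨ν, hνF, fun ε hε => ?_⟩
  by_contra hinf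
  have hsub : {z ∈ K \ F | ε ≤ ‖z - ν z‖} ⊆ K ∩ {z | ε ≤ infDist z F} := by
    rintro z ⟨hz, hz'⟩
    exact ⟨hz.1, by rw [mem_ofPred_eq, hν z, dist_eq_norm]; exact hz'⟩
  have hcpt : IsCompact (K ∩ {z | ε ≤ infDist z F}) :=
    hK.inter_right (isClosed_le continuous_const (continuous_infDist_pt F))
  obtain ⟨x, hx, hacc⟩ := Set.Infinite.exists_accPt_of_subset_isCompact hinf hcpt hsub
  refine h x (fun hxF => ?_) (hacc.mono (principal_mono.2 fun z hz => hz.1.1))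
  have := hx.2
  rw [mem_ofPred_eq, infDist_zero_of_mem hxF] at this
  linarith

theorem countable_diff_of_finite_setOf {K F : Set ℂ} {ν : ℂ → ℂ} (hν : ∀ z, ν z ∈ F)
    (h : ∀ ε > 0, {z ∈ K \ F | ε ≤ ‖z - ν z‖}.Finite) : (K \ F).Countable := by
  refine (countable_iUnion fun n : ℕ =>
    (h (1 / ((n : ℝ) + 1)) (by positivity)).countable).mono fun z hz => ?_
  have hpos : 0 < ‖z - ν z‖ := norm_pos_iff.2 fun h0 => hz.2 (by
    rw [sub_eq_zero.1 h0]; exact hν z)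
  obtain ⟨n, hn⟩ := exists_nat_one_div_lt hpos
  exact mem_iUnion.2 ⟨n, hz, hn.le⟩

end Topology

/-! ### Orthogonal projections and the kernel perturbation. -/

section CStarAlgebra

open Filter Topology Set

variable {A : Type*} [CStarAlgebra A]

/-- The range projection of an idempotent. -/
theorem exists_isSelfAdjoint_idempotent {P : A} (hP : P * P = P) :
    ∃ E : A, star E = E ∧ E * E = E ∧ E * P = P ∧ P * E = E := by
  have hP' : star P * star P = star P := by rw [← star_mul, hP]
  -- Its square is `1` plus a positive element of the form `star y * y`.
  have hunit : IsUnit (P + star P - 1) := by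
    have hx : IsUnit (1 + star (star P - P) * (star P - P)) := by
      have hs := spectrum_star_mul_self_nonneg (b := star P - P)
      by_contra hcon
      have : (-1 : ℝ) ∈ spectrum ℝ (star (star P - P) * (star P - P)) := by
        rw [spectrum.mem_iff, ← IsUnit.neg_iff]
        convert hcon using 2
        simp only [map_neg, map_one]; abel
      have := hs (-1) this
      norm_num at this
    have hsq : 1 + star (star P - P) * (star P - P) = (P + star P - 1) * (P + star P - 1) := by
      rw [star_sub, star_star]
      simp only [mul_add, mul_sub, add_mul, sub_mul, hP, hP', mul_one, one_mul]
      abel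
    rw [hsq] at hx
    exact ((Commute.refl _).isUnit_mul_iff.1 hx).1
  obtain ⟨h, hh⟩ := hunit
  have h1 : P * h = P * star P := by
    rw [hh, mul_sub, mul_add, hP, mul_one]; abel
  have h2 : h * star P = P * star P := by
    rw [hh, sub_mul, add_mul, hP', one_mul]; abel
  have hstar : star (h : A) = h := by
    rw [hh, star_sub, star_add, star_star, star_one, add_comm]
  have h3 : star P * ((h⁻¹ : Aˣ) : A) = ((h⁻¹ : Aˣ) : A) * P := by
    rw [Units.mul_inv_eq_iff_eq_mul, mul_assoc, Units.eq_inv_mul_iff_mul_eq, h1, h2]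
  have hEP : P * ((h⁻¹ : Aˣ) : A) * P = P := by
    rw [mul_assoc, ← h3, ← mul_assoc, ← h1, mul_assoc, Units.mul_inv, mul_one]
  have hstar' : star ((h⁻¹ : Aˣ) : A) = ((h⁻¹ : Aˣ) : A) := by
    have : star h = h := Units.ext hstar
    rw [← Units.coe_star, star_inv, this]
  have h4 : P * ((h⁻¹ : Aˣ) : A) = ((h⁻¹ : Aˣ) : A) * star P := by
    rw [Units.mul_inv_eq_iff_eq_mul, mul_assoc, Units.eq_inv_mul_iff_mul_eq, hh, mul_sub, mul_add,
      hP', mul_one, sub_mul, add_mul, hP, one_mul]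
    abel
  refine ⟨P * ((h⁻¹ : Aˣ) : A), ?_, ?_, hEP, ?_⟩
  · rw [star_mul, hstar', h4]
  · rw [← mul_assoc, hEP]
  · rw [← mul_assoc, hP]

/-- The projections define a star homomorphism from the C*-algebra of functions on `t`, and star
homomorphisms are contractive. -/
theorem norm_sum_smul_le_of_orthogonal {ι : Type*} {e : ι → A} (he : ∀ i, star (e i) = e i)
    (hee : ∀ i, e i * e i = e i) (hij : ∀ i j, i ≠ j → e i * e j = 0) {c : ι → ℂ} {M : ℝ}
    (hM : 0 ≤ M) {t : Finset ι} (hc : ∀ i ∈ t, ‖c i‖ ≤ M) : ‖∑ i ∈ t, c i • e i‖ ≤ M := by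
  classical
  let φ : (t → ℂ) →⋆ₙₐ[ℂ] A :=
    { toFun := fun x => ∑ i, x i • e i
      map_zero' := by simp
      map_add' := fun x y => by simp [add_smul, Finset.sum_add_distrib]
      map_smul' := fun r x => by simp [smul_smul, Finset.smul_sum]
      map_mul' := fun x y => by
        rw [Finset.sum_mul]
        refine Finset.sum_congr rfl fun i _ => ?_
        rw [Finset.mul_sum, Finset.sum_eq_single_of_mem i (Finset.mem_univ i)]
        · rw [smul_mul_smul_comm, hee, Pi.mul_apply]
        · intro j _ hji
          rw [smul_mul_smul_comm, hij i j (fun h => hji (Subtype.ext h.symm)), smul_zero]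
      map_star' := fun x => by simp [star_sum, he] }
  have h := NonUnitalStarAlgHom.norm_apply_le φ (fun i : t => c i)
  have h1 : φ (fun i : t => c i) = ∑ i ∈ t, c i • e i :=
    Finset.sum_coe_sort t (fun i => c i • e i)
  rw [h1] at h
  exact h.trans ((pi_norm_le_iff_of_nonneg hM).2 fun i => hc i i.2)

theorem summable_smul_of_orthogonal {ι : Type*} {e : ι → A} (he : ∀ i, star (e i) = e i)
    (hee : ∀ i, e i * e i = e i) (hij : ∀ i j, i ≠ j → e i * e j = 0) {c : ι → ℂ}
    (hc : ∀ ε > 0, {i | ε ≤ ‖c i‖}.Finite) : Summable fun i => c i • e i := by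
  rw [summable_iff_vanishing_norm]
  intro ε hε
  refine ⟨(hc (ε / 2) (by positivity)).toFinset, fun t ht => ?_⟩
  refine (norm_sum_smul_le_of_orthogonal he hee hij (M := ε / 2) (by positivity)
    fun i hi => ?_).trans_lt (by linarith)
  by_contra hcon
  exact Finset.disjoint_left.1 ht hi ((Set.Finite.mem_toFinset _).2 (not_le.1 hcon).le)

/-- Given orthogonal idempotents `p n` commuting with `a` on which `a - μ n` is quasinilpotent,
there is a perturbation `k`, in the closed ideal generated by the `p n`, which moves the part
`μ n` of the spectrum of `a` by `c n`. -/
theorem exists_triangular_perturbation {B : Type*} [CStarAlgebra B] (T : A →ₐ[ℂ] B)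
    (hT : Continuous T) {a : A} {μ c : ℕ → ℂ} {p : ℕ → A}
    (hpp : ∀ n, p n * p n = p n) (hpij : ∀ m n, m ≠ n → p m * p n = 0)
    (hpa : ∀ n, Commute (p n) a)
    (hq : ∀ n, spectralRadius ℂ ((a - algebraMap ℂ A (μ n)) * p n) = 0)
    (hTp : ∀ n, T (p n) = 0) (hc : ∀ ε > 0, {n | ε ≤ ‖c n‖}.Finite) :
    ∃ k : A, T k = 0 ∧ ∀ ν q, (∀ n, p n ≠ 0 → μ n - c n ≠ ν) → IsRieszIdempotent (a - k) ν q →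
      (∀ n, q * p n = 0) ∧ q * k = 0 := by
  set P : ℕ → A := fun n => ∑ i ∈ Finset.range n, p i with hPdef
  have hPs : ∀ n, P (n + 1) = P n + p n := fun n => Finset.sum_range_succ _ _
  have hPp : ∀ n i, i < n → P n * p i = p i := by
    intro n i hi
    rw [hPdef, Finset.sum_mul, Finset.sum_eq_single_of_mem i (Finset.mem_range.2 hi), hpp]
    exact fun j _ hj => hpij j i hj
  have hPP : ∀ m n, m ≤ n → P n * P m = P m := by
    intro m n hmn
    conv_lhs => rw [hPdef]
    change P n * ∑ i ∈ Finset.range m, p i = ∑ i ∈ Finset.range m, p i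
    rw [Finset.mul_sum]
    exact Finset.sum_congr rfl fun i hi => hPp n i ((Finset.mem_range.1 hi).trans_le hmn)
  choose E hEs hEE hEP hPE using fun n => exists_isSelfAdjoint_idempotent (hPP n n le_rfl)
  have hE : ∀ m n, m ≤ n → E n * E m = E m := by
    intro m n hmn
    have h1 : P n * E m = E m := by rw [← hPE m, ← mul_assoc, hPP m n hmn]
    rw [← h1, ← mul_assoc, hEP]
  have hE' : ∀ m n, m ≤ n → E m * E n = E m := by
    intro m n hmn
    have := congrArg star (hE m n hmn)
    rwa [star_mul, hEs, hEs] at this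
  have hEp : ∀ n i, i < n → E n * p i = p i := by
    intro n i hi
    rw [← hPp n i hi, ← mul_assoc, hEP]
  -- The `E n` are increasing projections, so their successive differences are mutually orthogonal.
  set e : ℕ → A := fun n => E (n + 1) - E n with hedef
  have hes : ∀ n, star (e n) = e n := fun n => by simp only [hedef, star_sub, hEs]
  have hee : ∀ n, e n * e n = e n := fun n => by
    simp only [hedef, mul_sub, sub_mul, hEE, hE n (n + 1) (by omega), hE' n (n + 1) (by omega)]
    abel
  have heE : ∀ n i, n ≤ i → e i * E n = 0 := fun n i hi => by
    simp only [hedef, sub_mul]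
    rw [hE n (i + 1) (by omega), hE n i hi, sub_self]
  have heij' : ∀ m n, m < n → e n * e m = 0 := fun m n hmn => by
    change e n * (E (m + 1) - E m) = 0
    rw [mul_sub, heE _ _ hmn, heE _ _ hmn.le, sub_self]
  have heij : ∀ m n, m ≠ n → e m * e n = 0 := fun m n hmn => by
    rcases lt_or_gt_of_ne hmn with h | h
    · have := congrArg star (heij' m n h)
      rwa [star_mul, hes, hes, star_zero] at this
    · exact heij' n m h
  have hsum : Summable fun n => c n • e n := summable_smul_of_orthogonal hes hee heij hc
  refine ⟨∑' n, c n • e n, ?_, ?_⟩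
  · have hTP : ∀ n, T (P n) = 0 := fun n => by
      simp only [hPdef, map_sum, hTp, Finset.sum_const_zero]
    have hTE : ∀ n, T (E n) = 0 := fun n => by rw [← hPE n, map_mul, hTP, zero_mul]
    have := hsum.map_tsum T hT
    rw [this]
    simp [hedef, hTE]
  · intro ν q hν hR
    set k := ∑' n, c n • e n with hk
    have hqk : q * k = ∑' n, c n • (q * e n) := by
      rw [hk, ← hsum.tsum_mul_left]; simp only [mul_smul_comm]
    have hsum' : Summable fun n => c n • (q * e n) := by
      simpa only [mul_smul_comm] using hsum.mul_left q
    have hqE : ∀ n, q * P n = 0 → q * E n = 0 := fun n h => by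
      rw [← hPE n, ← mul_assoc, h, zero_mul]
    -- Triangularity at work: once `q` kills `P n`, and hence `e i` for `i < n`, only the diagonal
    -- entry at `n` matters.
    have hqP : ∀ n, (∀ m ≤ n, q * P m = 0) := by
      intro n
      induction n with
      | zero => intro m hm; simp [hPdef, Nat.le_zero.1 hm]
      | succ n ih =>
        intro m hm
        rcases hm.lt_or_eq with hm | rfl
        · exact ih m (by omega)
        rw [hPs, mul_add, ih n le_rfl, zero_add]
        by_cases hp0 : p n = 0
        · rw [hp0, mul_zero]
        have hqe : ∀ i < n, q * e i = 0 := fun i hi => by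
          change q * (E (i + 1) - E i) = 0
          rw [mul_sub, hqE _ (ih (i + 1) hi), hqE _ (ih i hi.le), sub_self]
        -- Terms before `n` are killed by `q`, terms after `n` by `e i * E (n + 1) = 0`; at `n`, `q
        -- * E n = 0` and `E (n + 1)` fixes `p n`.
        have hqkp : q * k * p n = c n • (q * p n) := by
          rw [hqk, ← hsum'.tsum_mul_right, tsum_eq_single n]
          · change (c n • (q * (E (n + 1) - E n))) * p n = _
            rw [mul_sub, hqE n (ih n le_rfl), sub_zero, smul_mul_assoc, mul_assoc,
              hEp _ _ (Nat.lt_succ_self n)]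
          · intro i hi
            rcases lt_or_gt_of_ne hi with h | h
            · rw [hqe i h, smul_zero, zero_mul]
            · rw [smul_mul_assoc, mul_assoc, ← hEp (n + 1) n (Nat.lt_succ_self n),
                ← mul_assoc (e i), heE (n + 1) i h, zero_mul, mul_zero, smul_zero]
        have hlam : ν - (μ n - c n) ≠ 0 := sub_ne_zero.2 (hν n hp0).symm
        obtain ⟨u, hu⟩ := isUnit_of_spectralRadius_eq_zero (hq n) hlam
        refine eq_zero_of_eq_mul_mul (v := -((u⁻¹ : Aˣ) : A)) hR.quasinilpotent ?_
        have hpa' : Commute (p n) (a - algebraMap ℂ A (μ n)) :=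
          (hpa n).sub_right (Algebra.commutes _ _).symm
        -- On `q * p n`, left multiplication by `a - k - ν` is quasinilpotent but equals right
        -- multiplication by the unit `-u`.
        have key : (a - k - algebraMap ℂ A ν) * q * (q * p n) = -(q * p n * u) := by
          have e1 : (a - k - algebraMap ℂ A ν) * q * (q * p n)
              = q * (a - k - algebraMap ℂ A ν) * p n := by
            rw [(hR.commute_sub ν).eq, mul_assoc _ q, ← mul_assoc q q, hR.mul_self, mul_assoc _ q]
          have e2 : q * p n * ((a - algebraMap ℂ A (μ n)) * p n) =
              q * (a - algebraMap ℂ A (μ n)) * p n := by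
            rw [← hpa'.eq, mul_assoc, ← mul_assoc (p n), hpp, hpa'.eq, mul_assoc]
          rw [hu, mul_sub, e2, e1]
          have e3 : ∀ z : ℂ, q * algebraMap ℂ A z * p n = z • (q * p n) := fun z => by
            rw [← Algebra.commutes z q, mul_assoc, ← Algebra.smul_def]
          have e4 : ∀ z : ℂ, q * p n * algebraMap ℂ A z = z • (q * p n) := fun z => by
            rw [← Algebra.commutes, ← Algebra.smul_def]
          simp only [mul_sub, sub_mul, e3, e4, hqkp, sub_smul]
          abel
        rw [key, neg_mul_neg, mul_assoc, Units.mul_inv, mul_one]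
    have hqP' : ∀ n, q * P n = 0 := fun n => hqP n n le_rfl
    refine ⟨fun n => ?_, ?_⟩
    · have := hqP' (n + 1)
      rwa [hPs, mul_add, hqP' n, zero_add] at this
    · rw [hqk]
      simp [hedef, mul_sub, hqE _ (hqP' _)]

/-- If the spectrum of `a` accumulates only at points of a nonempty finite set `ω` and `T` kills
the spectral idempotents at the other points, then some perturbation of `a` by an element of the
kernel of `T` has no isolated spectral points outside `ω`. -/
theorem exists_ker_perturbation {B : Type*} [CStarAlgebra B] (T : A →ₐ[ℂ] B)
    (hT : Continuous T) {a : A} {ω : Set ℂ} (hω : ω.Finite) (hne : ω.Nonempty)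
    (hacc : ∀ z, z ∉ ω → ¬ AccPt z (𝓟 (spectrum ℂ a)))
    (hTp : ∀ z, z ∉ ω → ∀ p, IsRieszIdempotent a z p → T p = 0) :
    ∃ k : A, T k = 0 ∧ ∀ ν, ν ∉ ω → ∀ q, IsRieszIdempotent (a - k) ν q → q = 0 := by
  obtain ⟨ν, hν, hfin⟩ := exists_nearest_point (spectrum.isCompact a) hω hne hacc
  have hcount : (spectrum ℂ a \ ω).Countable := countable_diff_of_finite_setOf hν hfin
  choose! Q hQ using fun z (hz : z ∉ ω) => exists_isRieszIdempotent (hacc z hz)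
  have : Encodable (spectrum ℂ a \ ω : Set ℂ) := hcount.toEncodable
  -- `Encodable.decode₂` takes each point at exactly one index, so distinct indices give orthogonal
  -- idempotents. Unused indices get `0` throughout, which covers finite and infinite sets together
  -- and explains the guard `p n ≠ 0`.
  let f : ℕ → Option (spectrum ℂ a \ ω : Set ℂ) := Encodable.decode₂ _
  have hf : ∀ n s, f n = some s ↔ Encodable.encode s = n := fun n s =>
    Encodable.decode₂_eq_some
  let μ : ℕ → ℂ := fun n => (f n).elim 0 fun s => s
  let c : ℕ → ℂ := fun n => (f n).elim 0 fun s => s - ν s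
  let p : ℕ → A := fun n => (f n).elim 0 fun s => Q s
  have hcases : ∀ n, (p n = 0 ∧ c n = 0) ∨ ∃ s : (spectrum ℂ a \ ω : Set ℂ),
      f n = some s ∧ p n = Q s ∧ μ n = s ∧ c n = s - ν s := by
    intro n
    rcases hfn : f n with _ | s
    · left; simp [p, c, hfn]
    · right; exact ⟨s, rfl, by simp [p, hfn], by simp [μ, hfn], by simp [c, hfn]⟩
  obtain ⟨k, hTk, hk⟩ := exists_triangular_perturbation T hT (a := a) (μ := μ) (c := c) (p := p)
    (fun n => by
      rcases hcases n with h | ⟨s, -, h, -, -⟩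
      · rw [h.1, zero_mul]
      · rw [h]; exact (hQ s s.2.2).mul_self)
    (fun m n hmn => by
      rcases hcases m with h | ⟨s, hs, h, -, -⟩
      · rw [h.1, zero_mul]
      rcases hcases n with h' | ⟨t, ht, h', -, -⟩
      · rw [h'.1, mul_zero]
      rw [h, h']
      refine (hQ s s.2.2).mul_eq_zero (hQ t t.2.2) fun hst => hmn ?_
      rw [← (hf m s).1 hs, ← (hf n t).1 ht, Subtype.ext hst])
    (fun n => by
      rcases hcases n with h | ⟨s, -, h, -, -⟩
      · rw [h.1]; exact Commute.zero_left a
      · rw [h]; exact (hQ s s.2.2).commute_self)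
    (fun n => by
      rcases hcases n with h | ⟨s, -, h, h', -⟩
      · rw [h.1, mul_zero]
        exact spectralRadius_eq_zero_of_forall_isUnit fun z hz => by
          rw [sub_zero]; exact (IsUnit.mk0 z hz).map _
      · rw [h, h']; exact (hQ s s.2.2).quasinilpotent)
    (fun n => by
      rcases hcases n with h | ⟨s, -, h, -, -⟩
      · rw [h.1, map_zero]
      · rw [h]; exact hTp s s.2.2 _ (hQ s s.2.2))
    (fun ε hε => by
      refine (((hfin ε hε).preimage Subtype.val_injective.injOn).image
        (Encodable.encode : (spectrum ℂ a \ ω : Set ℂ) → ℕ)).subset fun n hn => ?_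
      rcases hcases n with h | ⟨s, hs, -, -, h⟩
      · have hn' : ε ≤ ‖c n‖ := hn
        rw [h.2, norm_zero] at hn'
        exact absurd hε (not_lt.2 hn')
      · refine ⟨s, ⟨s.2, ?_⟩, (hf n s).1 hs⟩
        rw [← h]; exact hn)
  refine ⟨k, hTk, fun z hz q hq => ?_⟩
  obtain ⟨hqp, hqk⟩ := hk z q (fun n hn => by
    rcases hcases n with h | ⟨s, -, -, h, h'⟩
    · exact absurd h.1 hn
    · rw [h, h', sub_sub_cancel]
      exact fun h0 => hz (h0 ▸ hν s)) hq
  have hqQ : q * Q z = 0 := by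
    by_cases hzs : z ∈ spectrum ℂ a
    · have hfz := (hf _ ⟨z, hzs, hz⟩).2 rfl
      have := hqp (Encodable.encode (⟨z, hzs, hz⟩ : (spectrum ℂ a \ ω : Set ℂ)))
      simpa [p, hfz] using this
    · have hT0 : Q z = 0 := (hQ z hz).map_eq_zero (AlgHom.id ℂ A) hzs
      rw [hT0, mul_zero]
  -- As `q` kills both `k` and `Q z`, `q = q * (a - z) * b = q * (a - k - z) * b`, to which the
  -- quasinilpotent cancellation applies.
  obtain ⟨b, -, hb⟩ := (hQ z hz).exists_inverse
  refine eq_zero_of_eq_mul_mul (v := b) hq.quasinilpotent ?_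
  have e1 : q * (a - k - algebraMap ℂ A z) = q * (a - algebraMap ℂ A z) := by
    rw [sub_right_comm, mul_sub, hqk, sub_zero]
  rw [mul_assoc _ q q, hq.mul_self, ← (hq.commute_sub z).eq, e1, mul_assoc, hb, mul_sub, hqQ,
    mul_one, sub_zero]

end CStarAlgebra

/-! ### Fredholm and Weyl spectra. -/

section FredholmTheory

open Filter Topology Set Polynomial HomFredholm

variable {A B : Type*} [CStarAlgebra A] [CStarAlgebra B]

theorem fredholmSpectrum_eq_spectrum (T : A →ₐ[ℂ] B) (a : A) :
    fredholmSpectrum T a = spectrum ℂ (T a) := by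
  ext z
  simp only [fredholmSpectrum, IsFredholm, map_sub, AlgHom.commutes]
  rfl

theorem fredholmSpectrum_subset_weylSpectrum (T : A →ₐ[ℂ] B) (a : A) :
    fredholmSpectrum T a ⊆ weylSpectrum T a := by
  rintro z hz ⟨c, d, hc, hd, h⟩
  apply hz
  rw [IsFredholm, h, map_add, hc, zero_add]
  exact hd.map T

theorem IsPolyRiesz.finite_fredholmSpectrum [Nontrivial B] {T : A →ₐ[ℂ] B} {a : A}
    (h : IsPolyRiesz T a) : (fredholmSpectrum T a).Finite := by
  obtain ⟨P, hP, hR⟩ := h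
  refine (P.roots.toFinset.finite_toSet).subset fun z hz => ?_
  rw [fredholmSpectrum_eq_spectrum] at hz
  have h1 : P.eval z ∈ spectrum ℂ (T (aeval a P)) := by
    rw [← Polynomial.aeval_algHom_apply, spectrum.map_polynomial_aeval]
    exact ⟨z, hz, rfl⟩
  rw [← fredholmSpectrum_eq_spectrum] at h1
  simp only [Finset.mem_coe, Multiset.mem_toFinset, mem_roots hP, IsRoot.def]
  by_contra h0
  exact h1 (hR _ h0)

theorem isPolyRiesz_of_finite [Nontrivial B] {T : A →ₐ[ℂ] B} {a : A}
    (h : (fredholmSpectrum T a).Finite) : IsPolyRiesz T a := by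
  refine ⟨∏ z ∈ h.toFinset, (X - C z), Finset.prod_ne_zero_iff.2 fun z _ => X_sub_C_ne_zero z,
    fun w hw => ?_⟩
  by_contra hcon
  have h1 : w ∈ fredholmSpectrum T (aeval a (∏ z ∈ h.toFinset, (X - C z))) := hcon
  rw [fredholmSpectrum_eq_spectrum, ← Polynomial.aeval_algHom_apply,
    spectrum.map_polynomial_aeval] at h1
  obtain ⟨y, hy, rfl⟩ := h1
  apply hw
  change eval y _ = 0
  rw [eval_prod]
  rw [← fredholmSpectrum_eq_spectrum] at hy
  exact Finset.prod_eq_zero (h.mem_toFinset.2 hy) (by simp)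

theorem not_accPt_of_strongRieszProperty {T : A →ₐ[ℂ] B} (hR : StrongRieszProperty T) {a : A}
    (h : (fredholmSpectrum T a).Finite) {z : ℂ} (hz : z ∉ fredholmSpectrum T a) :
    ¬ AccPt z (𝓟 (spectrum ℂ a)) :=
  not_accPt_of_frontier_subset (spectrum.isCompact a) h (hR a) hz

/-- Outside the Fredholm spectrum the spectral idempotent `p` lies in the kernel, and `z - a = p +
(z - a - p)` is a Weyl splitting. -/
theorem weylSpectrum_eq_fredholmSpectrum {T : A →ₐ[ℂ] B} (hR : StrongRieszProperty T) {a : A}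
    (h : (fredholmSpectrum T a).Finite) : weylSpectrum T a = fredholmSpectrum T a := by
  refine Subset.antisymm (fun z hz => ?_) (fredholmSpectrum_subset_weylSpectrum T a)
  by_contra hzF
  obtain ⟨p, hp⟩ := exists_isRieszIdempotent (not_accPt_of_strongRieszProperty hR h hzF)
  rw [fredholmSpectrum_eq_spectrum] at hzF
  refine hz ⟨p, algebraMap ℂ A z - a - p, hp.map_eq_zero T hzF, ?_, by abel⟩
  have := hp.isUnit_sub_add
  rw [← IsUnit.neg_iff] at this
  convert this using 1
  abel

theorem IsBoundedHom.continuous {T : A →ₐ[ℂ] B} (h : IsBoundedHom T) : Continuous T := by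
  obtain ⟨C, hC⟩ := h
  exact AddMonoidHomClass.continuous_of_bound T C hC

theorem exists_decomposition [Nontrivial A] [Nontrivial B] {T : A →ₐ[ℂ] B}
    (hT : IsBoundedHom T) (hR : StrongRieszProperty T) {a : A}
    (h : (fredholmSpectrum T a).Finite) :
    ∃ c d f : A, a = c + d + f ∧ T c = 0 ∧ IsQuasinilpotent d ∧
      spectrum ℂ f = fredholmSpectrum T a := by
  have hne : (fredholmSpectrum T a).Nonempty := by
    rw [fredholmSpectrum_eq_spectrum]; exact spectrum.nonempty _
  obtain ⟨k, hTk, hk⟩ := exists_ker_perturbation T (IsBoundedHom.continuous hT) h hne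
    (fun z hz => not_accPt_of_strongRieszProperty hR h hz)
    (fun z hz p hp => hp.map_eq_zero T (by rwa [← fredholmSpectrum_eq_spectrum]))
  -- This allows the strong Riesz property to be used for `a - k` with the same finite set.
  have hfs : fredholmSpectrum T (a - k) = fredholmSpectrum T a := by
    rw [fredholmSpectrum_eq_spectrum, fredholmSpectrum_eq_spectrum, map_sub, hTk, sub_zero]
  have hspec : spectrum ℂ (a - k) = fredholmSpectrum T a := by
    refine Subset.antisymm (fun z hz => ?_) ?_
    · by_contra hzF
      obtain ⟨q, hq⟩ := exists_isRieszIdempotent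
        (not_accPt_of_strongRieszProperty hR (hfs ▸ h) (hfs ▸ hzF))
      exact hq.notMem_spectrum (hk z hzF q hq) hz
    · rw [← hfs, fredholmSpectrum_eq_spectrum]
      exact AlgHom.spectrum_apply_subset T (a - k)
  obtain ⟨d, f, hdf, hd, hf⟩ := exists_add_of_finite_spectrum (hspec ▸ h)
  exact ⟨k, d, f, by rw [add_assoc, ← hdf]; abel, hTk, hd, hf.trans hspec⟩

end FredholmTheory

theorem mainTheorem2 {A B : Type*} [CStarAlgebra A] [CStarAlgebra B]
    [Nontrivial A] [Nontrivial B] (T : A →ₐ[ℂ] B)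
    (hT : HomFredholm.IsBoundedHom T) (hR : HomFredholm.StrongRieszProperty T) (a : A) :
    (HomFredholm.IsPolyRiesz T a ↔ (HomFredholm.weylSpectrum T a).Finite) ∧
    (HomFredholm.IsPolyRiesz T a →
      ∃ c d f : A, a = c + d + f ∧ T c = 0 ∧ HomFredholm.IsQuasinilpotent d ∧
        spectrum ℂ f = HomFredholm.weylSpectrum T a) := by
  refine ⟨⟨fun h => ?_, fun h => isPolyRiesz_of_finite
    (h.subset (fredholmSpectrum_subset_weylSpectrum T a))⟩, fun h => ?_⟩
  · rw [weylSpectrum_eq_fredholmSpectrum hR (IsPolyRiesz.finite_fredholmSpectrum h)]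
    exact IsPolyRiesz.finite_fredholmSpectrum h
  · rw [weylSpectrum_eq_fredholmSpectrum hR (IsPolyRiesz.finite_fredholmSpectrum h)]
    exact exists_decomposition hT hR (IsPolyRiesz.finite_fredholmSpectrum h)
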